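/- **Definitions.** Let $\mathbb{C}_\infty$ be the Riemann sphere. For a compact set $E\subset\mathbb{C}$ put $\Omega=\mathbb{C}_\infty\setminus E$. The set $E$ is *$H^\infty$-removable* if every bounded holomorphic function $f:\Omega\to\mathbb{C}$ is constant, and *$A$-removable* if every continuous function $f:\mathbb{C}_\infty\to\mathbb{C}$ that is holomorphic on $\Omega$ is constant. For $s>0$, an *$s$-Frostman measure on $E$* is a nontrivial positive Borel measure $\mu$ on $\mathbb{C}$ with $\mu(\mathbb{C}\setminus E)=0$ and $\mu(\mathbb{D}(z_0,r))\le r^s$ for all $z_0\in\mathbb{C}$ and $r>0$. Its *Cauchy transform* is $$\mathcal{C}\mu(z)=\int\frac{d\mu(\zeta)}{\zeta-z}\quad(z\in\mathbb{C}\setminus E),\qquad \mathcal{C}\mu(\infty)=0 .$$ **Theorem.** 1. Let $E\subset\mathbb{C}$ be compact with $\dim_{\mathcal H}(E)>1$. Then $E$ is not $H^\infty$-removable; in fact, $E$ is not even $A$-removable. Moreover, there is an $s$-Frostman measure on $E$ for some $1<s<2$. 2. For every $1<s<2$ there is a constant $C$, depending only on $s$, such that for every compact set $E\subset\mathbb{C}$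 and every $s$-Frostman measure $\mu$ on $E$, the function $\mathcal{C}\mu$ is holomorphic on $\Omega$, is not constant on $\Omega$, satisfies $$|\mathcal{C}\mu(z)-\mathcal{C}\mu(w)|\le C\,|z-w|^{s-1}\qquad(z,w\in\mathbb{C}\setminus E),$$ and extends to a continuous function on $\mathbb{C}_\infty$. -/

import Mathlib

open MeasureTheory
open scoped ENNReal OnePoint

noncomputable section

/-- The chart `w ↦ 1 / w` of the Riemann sphere `OnePoint ℂ` around `∞` (with `1 / 0 = ∞`). -/
def chartAtInfty (w : ℂ) : OnePoint ℂ :=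
  if w = 0 then ∞ else ((w⁻¹ : ℂ) : OnePoint ℂ)

/-- `f` is holomorphic on the open subset `U` of the Riemann sphere: it is complex differentiable
at the points of `U` in each of the two standard charts `z ↦ z` and `w ↦ 1 / w`. -/
def SphereHolomorphicOn (f : OnePoint ℂ → ℂ) (U : Set (OnePoint ℂ)) : Prop :=
  DifferentiableOn ℂ (fun z : ℂ => f (z : OnePoint ℂ)) {z : ℂ | (z : OnePoint ℂ) ∈ U} ∧
    DifferentiableOn ℂ (fun w : ℂ => f (chartAtInfty w)) {w : ℂ | chartAtInfty w ∈ U}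

/-- The complement of `E ⊆ ℂ` in the Riemann sphere. -/
def sphereCompl (E : Set ℂ) : Set (OnePoint ℂ) :=
  ((fun z : ℂ => (z : OnePoint ℂ)) '' E)ᶜ

/-- The class `H^∞` of bounded holomorphic functions on `U`. Only the values of `f` on `U`
matter. -/
def ClassHInfty (U : Set (OnePoint ℂ)) : Set (OnePoint ℂ → ℂ) :=
  {f | SphereHolomorphicOn f U ∧ ∃ M : ℝ, ∀ x ∈ U, ‖f x‖ ≤ M}

/-- The class `A` of continuous functions on the whole sphere that are holomorphic on `U`. -/
def ClassA (U : Set (OnePoint ℂ)) : Set (OnePoint ℂ → ℂ) :=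
  {f | Continuous f ∧ SphereHolomorphicOn f U}

/-- Every bounded holomorphic function on the complement of `E` in the sphere is constant there. -/
def HInftyRemovable (E : Set ℂ) : Prop :=
  ∀ f ∈ ClassHInfty (sphereCompl E), ∃ c : ℂ, ∀ x ∈ sphereCompl E, f x = c

/-- Every continuous function on the sphere that is holomorphic off `E` is constant. -/
def ARemovable (E : Set ℂ) : Prop :=
  ∀ f ∈ ClassA (sphereCompl E), ∃ c : ℂ, ∀ x : OnePoint ℂ, f x = c

/-- `μ` is a nontrivial positive Borel measure supported on `E` with growth `r ^ s`. -/
structure IsFrostmanMeasure (μ : Measure ℂ) (E : Set ℂ) (s : ℝ) : Prop where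
  ne_zero : μ ≠ 0
  supported : μ Eᶜ = 0
  growth : ∀ (z₀ : ℂ) (r : ℝ), 0 < r → μ (Metric.ball z₀ r) ≤ ENNReal.ofReal (r ^ s)

/-- The Cauchy transform `z ↦ ∫ dμ(ζ) / (ζ - z)` as a function on the sphere, with value `0`
at `∞`. -/
def cauchyTransform (μ : Measure ℂ) : OnePoint ℂ → ℂ
  | ∞ => 0
  | (z : ℂ) => ∫ ζ, 1 / (ζ - z) ∂μ

end

/-! Frostman's lemma is obtained by duality. The weighted content of a function is the least cost `∑
cᵢ rᵢ ^ s` of a weighted family of balls dominating it on `E`; it is sublinear, and by a Vitali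
argument it is positive on a bump equal to `1` on `E`. Hahn–Banach gives a linear functional below
the content and equal to it on the bump. It is positive, so Riesz gives a measure: one ball of
weight `1` bounds its growth, and functions vanishing on `E` cost nothing, so it lives on `E`.

For the Cauchy transform, put `δ = |z - w|` and split at distance `2δ` from `z`. Near `z` the two
kernels are integrated separately, which converges since `s > 1`; far away their difference is at
most `2δ / |ζ - z| ^ 2`, which converges since `s < 2`. Both parts are of order `δ ^ (s - 1)`, also
for points of `E`, so the integral itself is the continuous extension. It is not constant because it
vanishes at `∞` with leading coefficient `-μ(E) ≠ 0` in the variable `1 / z`. -/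

section Frostman

open Set Metric Filter Topology
open scoped CompactlySupported

/-! ### Covers and weighted covers by balls -/

/-- Positive Hausdorff measure bounds from below the sums `∑ rᵢ ^ s` over finite covers by balls. -/
theorem exists_pos_le_sum_rpow_of_hausdorffMeasure_ne_zero {X : Type*} [MetricSpace X]
    [MeasurableSpace X] [BorelSpace X] {E : Set X} {s : ℝ} (hs : 0 < s)
    (hE : Measure.hausdorffMeasure s E ≠ 0) :
    ∃ δ : ℝ, 0 < δ ∧ ∀ (ι : Type) [Fintype ι] (x : ι → X) (r : ι → ℝ), (∀ i, 0 ≤ r i) →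
      E ⊆ ⋃ i, closedBall (x i) (r i) → δ ≤ ∑ i, r i ^ s := by
  by_contra! H
  have hpos : ∀ n : ℕ, (0 : ℝ) < 1 / ((n : ℝ) + 1) := fun n => by positivity
  choose ι hι x r hr hcov hsum using fun n : ℕ => H _ (hpos n)
  -- A small sum of `s`-th powers makes every radius small, so these covers are automatically fine
  -- enough to compute Hausdorff measure.
  have hri : ∀ n i, r n i ≤ (1 / ((n : ℝ) + 1)) ^ (1 / s) := fun n i => by
    have h1 : r n i ^ s ≤ 1 / ((n : ℝ) + 1) :=
      (Finset.single_le_sum (f := fun i => r n i ^ s)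
        (fun j _ => Real.rpow_nonneg (hr n j) s) (Finset.mem_univ i)).trans (hsum n).le
    calc r n i = (r n i ^ s) ^ (1 / s) := by
          rw [← Real.rpow_mul (hr n i), mul_one_div_cancel hs.ne', Real.rpow_one]
      _ ≤ _ := Real.rpow_le_rpow (Real.rpow_nonneg (hr n i) s) h1 (by positivity)
  have hdiam : ∀ n i, ediam (closedBall (x n i) (r n i)) ≤ ENNReal.ofReal (2 * r n i) :=
    fun n i => by
      refine ediam_le fun y hy z hz => ?_
      rw [edist_dist]
      refine ENNReal.ofReal_le_ofReal ?_
      have := dist_triangle_right y z (x n i)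
      rw [mem_closedBall] at hy hz
      linarith
  have hlim : Tendsto (fun n : ℕ => 1 / ((n : ℝ) + 1)) atTop (𝓝 0) :=
    tendsto_one_div_add_atTop_nhds_zero_nat
  have hR : Tendsto (fun n : ℕ => ENNReal.ofReal (2 * (1 / ((n : ℝ) + 1)) ^ (1 / s))) atTop
      (𝓝 0) := by
    have h1 := (hlim.rpow_const (p := 1 / s) (Or.inr (by positivity))).const_mul 2
    rw [Real.zero_rpow (by positivity), mul_zero] at h1
    simpa using ENNReal.tendsto_ofReal h1
  have hle := Measure.hausdorffMeasure_le_liminf_sum s E _ hR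
    (fun n i => closedBall (x n i) (r n i))
    (Eventually.of_forall fun n i => (hdiam n i).trans
      (ENNReal.ofReal_le_ofReal (mul_le_mul_of_nonneg_left (hri n i) zero_le_two)))
    (Eventually.of_forall hcov)
  have hterm : ∀ n, ∑ i, ediam (closedBall (x n i) (r n i)) ^ s
      ≤ ENNReal.ofReal (2 ^ s * (1 / ((n : ℝ) + 1))) := fun n => by
    calc ∑ i, ediam (closedBall (x n i) (r n i)) ^ s
        ≤ ∑ i, ENNReal.ofReal (2 ^ s * r n i ^ s) := by
          refine Finset.sum_le_sum fun i _ => ?_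
          rw [← Real.mul_rpow zero_le_two (hr n i),
            ← ENNReal.ofReal_rpow_of_nonneg (mul_nonneg zero_le_two (hr n i)) hs.le]
          exact ENNReal.rpow_le_rpow (hdiam n i) hs.le
      _ = ENNReal.ofReal (2 ^ s * ∑ i, r n i ^ s) := by
          rw [Finset.mul_sum, ENNReal.ofReal_sum_of_nonneg]
          exact fun i _ => mul_nonneg (by positivity) (Real.rpow_nonneg (hr n i) s)
      _ ≤ _ := ENNReal.ofReal_le_ofReal
          (mul_le_mul_of_nonneg_left (hsum n).le (by positivity))
  have hlim2 : Tendsto (fun n : ℕ => ENNReal.ofReal (2 ^ s * (1 / ((n : ℝ) + 1)))) atTop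
      (𝓝 0) := by
    have h1 := hlim.const_mul ((2 : ℝ) ^ s)
    rw [mul_zero] at h1
    simpa using ENNReal.tendsto_ofReal h1
  refine hE (le_antisymm (hle.trans ?_) zero_le)
  exact (liminf_le_liminf (Eventually.of_forall hterm)).trans hlim2.liminf_eq.le

/-- A weighted cover of `E` by balls costs at least `5⁻ˢ` times the bound for plain covers:
Vitali's covering theorem peels disjoint subfamilies off the weighted cover. -/
theorem mul_le_sum_of_weighted_cover {X : Type*} [MetricSpace X] {E : Set X} {s δ : ℝ}
    (hE : E.Nonempty)
    (hcov : ∀ (ι : Type) [Fintype ι] (x : ι → X) (r : ι → ℝ), (∀ i, 0 ≤ r i) →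
      E ⊆ ⋃ i, closedBall (x i) (r i) → δ ≤ ∑ i, r i ^ s) (hδ : 0 ≤ δ)
    {ι : Type} [Fintype ι] (x : ι → X) (r : ι → ℝ) (hr : ∀ i, 0 < r i) (c : ι → ℝ)
    (hc : ∀ i, 0 ≤ c i) (a : ℝ)
    (ha : ∀ y ∈ E, a ≤ ∑ i, c i * (closedBall (x i) (r i)).indicator 1 y) :
    δ * a ≤ 5 ^ s * ∑ i, c i * r i ^ s := by
  classical
  -- Induction on the number of balls of positive weight.
  induction hk : (Finset.univ.filter fun i => 0 < c i).card using Nat.strong_induction_on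
    generalizing c a with
  | _ k ih =>
  have hrs : ∀ i, 0 ≤ r i ^ s := fun i => Real.rpow_nonneg (hr i).le s
  rcases le_or_gt a 0 with ha0 | ha0
  · exact (mul_nonpos_of_nonneg_of_nonpos hδ ha0).trans
      (mul_nonneg (by positivity) (Finset.sum_nonneg fun i _ => mul_nonneg (hc i) (hrs i)))
  obtain ⟨u, hut, hdisj, hu⟩ := Vitali.exists_disjoint_subfamily_covering_enlargement_closedBall
    {i | 0 < c i} x r (∑ i, r i)
    (fun i _ => Finset.single_le_sum (fun j _ => (hr j).le) (Finset.mem_univ i)) 5 (by norm_num)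
  have hpos : ∀ y ∈ E, ∃ i, 0 < c i ∧ y ∈ closedBall (x i) (r i) := fun y hy => by
    by_contra! H
    refine (ha0.trans_le (ha y hy)).ne' (Finset.sum_eq_zero fun i _ => ?_)
    rcases (hc i).eq_or_lt with h | h
    · rw [← h, zero_mul]
    · rw [indicator_of_notMem (H i h), mul_zero]
  have hcovu : E ⊆ ⋃ i : u, closedBall (x i) (5 * r i) := fun y hy => by
    obtain ⟨i, hi, hyi⟩ := hpos y hy
    obtain ⟨b, hb, hsub⟩ := hu i hi
    exact mem_iUnion.2 ⟨⟨b, hb⟩, hsub hyi⟩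
  have hsumu : δ ≤ 5 ^ s * ∑ i ∈ Finset.univ.filter (· ∈ u), r i ^ s := by
    refine (hcov u (fun i => x i) (fun i => 5 * r i)
      (fun i => by have := hr i; positivity) hcovu).trans_eq ?_
    rw [Finset.mul_sum, Finset.sum_subtype (p := (· ∈ u)) _ (by simp)]
    exact Finset.sum_congr rfl fun i _ => Real.mul_rpow (by norm_num) (hr i).le
  have hune : (Finset.univ.filter (· ∈ u)).Nonempty := by
    obtain ⟨y, hy⟩ := hE
    obtain ⟨i, -⟩ := mem_iUnion.1 (hcovu hy)
    exact ⟨i, by simp⟩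
  obtain ⟨m, hm, hmin⟩ := Finset.exists_min_image _ c hune
  have hmu : m ∈ u := by simpa using hm
  have hmin' : ∀ i ∈ u, c m ≤ c i := fun i hi => hmin i (by simpa using hi)
  have hcm : 0 < c m := hut hmu
  -- Lower the weights on the disjoint family `u` by their minimum. By disjointness no point loses
  -- more than `c m`, the ball `m` drops out, and the cost falls by at least `c m * δ / 5 ^ s`,
  -- since the enlarged balls cover `E`.
  set c' : ι → ℝ := fun i => c i - if i ∈ u then c m else 0 with hc'
  have hc'nn : ∀ i, 0 ≤ c' i := fun i => by
    by_cases hi : i ∈ u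
    · simpa [hc', hi] using hmin' i hi
    · simpa [hc', hi] using hc i
  have hcard : (Finset.univ.filter fun i => 0 < c' i).card < k := by
    rw [← hk]
    refine Finset.card_lt_card (Finset.ssubset_iff_of_subset ?_ |>.2 ⟨m, ?_, ?_⟩)
    · intro i
      simp only [Finset.mem_filter, Finset.mem_univ, true_and, hc']
      intro h
      split_ifs at h <;> linarith
    · simpa using hcm
    · simp [hc', hmu]
  have ha' : ∀ y ∈ E, a - c m ≤ ∑ i, c' i * (closedBall (x i) (r i)).indicator 1 y :=
    fun y hy => by
    have hone : ∑ i, (if i ∈ u then c m else 0) * (closedBall (x i) (r i)).indicator 1 y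
        ≤ c m := by
      by_cases hex : ∃ j ∈ u, y ∈ closedBall (x j) (r j)
      · obtain ⟨j, hj, hyj⟩ := hex
        rw [Finset.sum_eq_single j]
        · simp [hj, indicator_of_mem hyj]
        · intro i _ hij
          by_cases hi : i ∈ u
          · rw [indicator_of_notMem (fun hyi => (hdisj hi hj hij).le_bot ⟨hyi, hyj⟩), mul_zero]
          · simp [hi]
        · simp
      · push Not at hex
        refine (Finset.sum_eq_zero fun i _ => ?_).trans_le hcm.le
        by_cases hi : i ∈ u
        · rw [indicator_of_notMem (hex i hi), mul_zero]
        · simp [hi]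
    simp only [hc', sub_mul, Finset.sum_sub_distrib]
    have := ha y hy
    linarith
  have key := ih _ hcard c' hc'nn (a - c m) ha' rfl
  have hsplit : ∑ i, c' i * r i ^ s
      = ∑ i, c i * r i ^ s - c m * ∑ i ∈ Finset.univ.filter (· ∈ u), r i ^ s := by
    simp only [hc', sub_mul, Finset.sum_sub_distrib, ite_mul, zero_mul]
    rw [← Finset.sum_filter, Finset.mul_sum]
  rw [hsplit] at key
  have := mul_le_mul_of_nonneg_left hsumu hcm.le
  linarith

/-! ### The weighted content as a sublinear functional -/

/-- The costs `∑ cᵢ rᵢ ^ s` of the finite weighted families of balls that dominate `f` on `E`. -/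
def weightedCoverCosts {X : Type*} [MetricSpace X] (E : Set X) (s : ℝ) (f : X → ℝ) : Set ℝ :=
  {v | ∃ (ι : Type) (_ : Fintype ι) (x : ι → X) (r c : ι → ℝ), (∀ i, 0 < r i) ∧ (∀ i, 0 ≤ c i) ∧
    (∀ y ∈ E, f y ≤ ∑ i, c i * (closedBall (x i) (r i)).indicator 1 y) ∧
    v = ∑ i, c i * r i ^ s}

/-- The weighted Hausdorff content of `f` on `E`. -/
noncomputable def weightedContent {X : Type*} [MetricSpace X] (E : Set X) (s : ℝ) (f : X → ℝ) : ℝ :=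
  sInf (weightedCoverCosts E s f)

section weightedContent

variable {X : Type*} [MetricSpace X] {E : Set X} {s : ℝ} {f g : X → ℝ} {v w : ℝ}

theorem nonneg_of_mem_weightedCoverCosts (hv : v ∈ weightedCoverCosts E s f) : 0 ≤ v := by
  obtain ⟨ι, _, x, r, c, hr, hc, -, rfl⟩ := hv
  exact Finset.sum_nonneg fun i _ => mul_nonneg (hc i) (Real.rpow_nonneg (hr i).le s)

theorem bddBelow_weightedCoverCosts : BddBelow (weightedCoverCosts E s f) :=
  ⟨0, fun _ => nonneg_of_mem_weightedCoverCosts⟩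

theorem weightedContent_nonneg : 0 ≤ weightedContent E s f :=
  Real.sInf_nonneg fun _ => nonneg_of_mem_weightedCoverCosts

theorem weightedContent_le (hv : v ∈ weightedCoverCosts E s f) : weightedContent E s f ≤ v :=
  csInf_le bddBelow_weightedCoverCosts hv

theorem nonempty_weightedCoverCosts [Nonempty X] (hE : IsCompact E) (hf : Continuous f) :
    (weightedCoverCosts E s f).Nonempty := by
  obtain ⟨M, hM⟩ := hE.bddAbove_image hf.continuousOn
  obtain ⟨x₀⟩ := ‹Nonempty X›
  obtain ⟨R, hR⟩ := hE.isBounded.subset_closedBall x₀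
  refine ⟨_, Unit, inferInstance, fun _ => x₀, fun _ => max R 1, fun _ => max M 0,
    fun _ => by positivity, fun _ => le_max_right _ _, fun y hy => ?_, rfl⟩
  have : y ∈ closedBall x₀ (max R 1) := closedBall_subset_closedBall (le_max_left _ _) (hR hy)
  simpa [indicator_of_mem this] using Or.inl (hM ⟨y, hy, rfl⟩)

theorem add_mem_weightedCoverCosts (hv : v ∈ weightedCoverCosts E s f)
    (hw : w ∈ weightedCoverCosts E s g) : v + w ∈ weightedCoverCosts E s (f + g) := by
  obtain ⟨ι, _, x, r, c, hr, hc, hf, rfl⟩ := hv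
  obtain ⟨κ, _, x', r', c', hr', hc', hg, rfl⟩ := hw
  refine ⟨ι ⊕ κ, inferInstance, Sum.elim x x', Sum.elim r r', Sum.elim c c', ?_, ?_,
    fun y hy => ?_, ?_⟩
  · rintro (i | i) <;> simp [hr, hr']
  · rintro (i | i) <;> simp [hc, hc']
  · simpa using add_le_add (hf y hy) (hg y hy)
  · simp

theorem smul_mem_weightedCoverCosts {t : ℝ} (ht : 0 ≤ t) (hv : v ∈ weightedCoverCosts E s f) :
    t * v ∈ weightedCoverCosts E s (t • f) := by
  obtain ⟨ι, _, x, r, c, hr, hc, hf, rfl⟩ := hv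
  refine ⟨ι, inferInstance, x, r, fun i => t * c i, hr, fun i => mul_nonneg ht (hc i),
    fun y hy => ?_, ?_⟩
  · simpa [Finset.mul_sum, mul_assoc] using mul_le_mul_of_nonneg_left (hf y hy) ht
  · simp [Finset.mul_sum, mul_assoc]

theorem weightedContent_add_le [Nonempty X] (hE : IsCompact E) (hf : Continuous f)
    (hg : Continuous g) :
    weightedContent E s (f + g) ≤ weightedContent E s f + weightedContent E s g := by
  have h1 : ∀ v ∈ weightedCoverCosts E s f, ∀ w ∈ weightedCoverCosts E s g,
      weightedContent E s (f + g) ≤ v + w := fun v hv w hw =>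
    weightedContent_le (add_mem_weightedCoverCosts hv hw)
  have h2 : ∀ v ∈ weightedCoverCosts E s f,
      weightedContent E s (f + g) - v ≤ weightedContent E s g := fun v hv =>
    le_csInf (nonempty_weightedCoverCosts hE hg) fun w hw => by linarith [h1 v hv w hw]
  have h3 : weightedContent E s (f + g) - weightedContent E s g ≤ weightedContent E s f :=
    le_csInf (nonempty_weightedCoverCosts hE hf) fun v hv => by linarith [h2 v hv]
  linarith

theorem weightedContent_smul_le [Nonempty X] (hE : IsCompact E) (hf : Continuous f) {t : ℝ}
    (ht : 0 < t) : weightedContent E s (t • f) ≤ t * weightedContent E s f := by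
  rw [← div_le_iff₀' ht]
  refine le_csInf (nonempty_weightedCoverCosts hE hf) fun v hv => ?_
  rw [div_le_iff₀' ht]
  exact weightedContent_le (smul_mem_weightedCoverCosts ht.le hv)

theorem weightedContent_smul [Nonempty X] (hE : IsCompact E) (hf : Continuous f) {t : ℝ}
    (ht : 0 < t) : weightedContent E s (t • f) = t * weightedContent E s f := by
  refine le_antisymm (weightedContent_smul_le hE hf ht) ?_
  have h := weightedContent_smul_le (s := s) hE (hf.const_smul t) (inv_pos.2 ht)
  rwa [inv_smul_smul₀ ht.ne', ← div_eq_inv_mul, le_div_iff₀' ht] at h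

/-- The empty family is admissible. This yields both positivity of the Hahn–Banach functional and
the vanishing of the measure off `E`. -/
theorem weightedContent_le_zero (hf : ∀ y ∈ E, f y ≤ 0) : weightedContent E s f ≤ 0 :=
  weightedContent_le ⟨Empty, inferInstance, Empty.elim, Empty.elim, Empty.elim, by simp, by simp,
    fun y hy => by simpa using hf y hy, by simp⟩

theorem weightedContent_le_rpow {x : X} {r : ℝ} (hr : 0 < r)
    (hf : ∀ y ∈ E, f y ≤ (closedBall x r).indicator 1 y) : weightedContent E s f ≤ r ^ s :=
  weightedContent_le ⟨Unit, inferInstance, fun _ => x, fun _ => r, fun _ => 1, by simpa, by simp,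
    fun y hy => by simpa using hf y hy, by simp⟩

end weightedContent

/-! ### Frostman's lemma by Hahn–Banach and Riesz -/

/-- **Frostman's lemma** for compact sets. -/
theorem exists_measure_ball_le_rpow_of_hausdorffMeasure_ne_zero {X : Type*} [MetricSpace X]
    [LocallyCompactSpace X] [MeasurableSpace X] [BorelSpace X] {E : Set X} (hE : IsCompact E)
    {s : ℝ} (hs : 0 < s) (hpos : Measure.hausdorffMeasure s E ≠ 0) :
    ∃ μ : Measure X, μ ≠ 0 ∧ μ Eᶜ = 0 ∧
      ∀ (x : X) (r : ℝ), 0 < r → μ (ball x r) ≤ ENNReal.ofReal (r ^ s) := by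
  have hEne : E.Nonempty := nonempty_iff_ne_empty.2 fun h => hpos (by simp [h])
  have : Nonempty X := ⟨hEne.some⟩
  obtain ⟨f₀, hf₀E, -, hf₀c, hf₀⟩ := exists_continuous_one_zero_of_isCompact hE isClosed_empty
    (disjoint_empty E)
  set F₀ : C_c(X, ℝ) := ⟨f₀, hf₀c⟩
  set N : C_c(X, ℝ) → ℝ := fun f => weightedContent E s f
  have hNpos : 0 < N F₀ := by
    obtain ⟨δ, hδ, hcov⟩ := exists_pos_le_sum_rpow_of_hausdorffMeasure_ne_zero hs hpos
    refine (show 0 < δ / 5 ^ s by positivity).trans_le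
      (le_csInf (nonempty_weightedCoverCosts hE F₀.continuous) ?_)
    rintro v ⟨ι, _, x, r, c, hr, hc, hf, rfl⟩
    rw [div_le_iff₀' (by positivity)]
    simpa using mul_le_sum_of_weighted_cover hEne hcov hδ.le x r hr c hc 1
      fun y hy => (hf₀E hy).symm.trans_le (hf y hy)
  have hF₀ne : F₀ ≠ 0 := fun h => by
    obtain ⟨y, hy⟩ := hEne
    have h1 : F₀ y = 1 := hf₀E hy
    simp [h] at h1
  obtain ⟨L, hL₀, hLN⟩ := exists_extension_of_le_sublinear
    (LinearPMap.mkSpanSingleton F₀ (N F₀) hF₀ne) N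
    (fun t ht f => weightedContent_smul hE f.continuous ht)
    (fun f g => weightedContent_add_le hE f.continuous g.continuous) (by
      rintro ⟨y, hy⟩
      obtain ⟨t, rfl⟩ := Submodule.mem_span_singleton.1 hy
      rw [LinearPMap.mkSpanSingleton'_apply]
      -- For `t ≤ 0` homogeneity is unavailable, but `t * N F₀ ≤ 0 ≤ N (t • F₀)`.
      rcases le_or_gt t 0 with ht | ht
      · exact (mul_nonpos_of_nonpos_of_nonneg ht hNpos.le).trans weightedContent_nonneg
      · exact (weightedContent_smul hE F₀.continuous ht).ge)
  have hLF₀ : L F₀ = N F₀ :=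
    (hL₀ ⟨F₀, Submodule.mem_span_singleton_self F₀⟩).trans
      (LinearPMap.mkSpanSingleton'_apply_self _ _ _ _)
  have hLnn : ∀ f : C_c(X, ℝ), 0 ≤ f → 0 ≤ L f := fun f hf => by
    have h : N (-f) ≤ 0 := weightedContent_le_zero fun y _ => by simpa using hf y
    have h2 := (hLN (-f)).trans h
    rw [map_neg] at h2
    linarith
  set Λ : C_c(X, ℝ) →ₚ[ℝ] ℝ := PositiveLinearMap.mk₀ L hLnn
  -- By inner regularity on open sets, it suffices to test with bumps that are `1` on a compact `K ⊆
  -- U` and `0` off `U`.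
  have hopen : ∀ (U : Set X), IsOpen U → ∀ b : ℝ,
      (∀ f : C_c(X, ℝ), (∀ y, f y ≤ 1) → (∀ y ∉ U, f y = 0) → N f ≤ b) →
      RealRMK.rieszMeasure Λ U ≤ ENNReal.ofReal b := fun U hU b hb => by
    rw [hU.measure_eq_iSup_isCompact]
    refine iSup₂_le fun K hKU => iSup_le fun hK => ?_
    obtain ⟨f, hfK, hfU, hfc, hf⟩ := exists_continuous_one_zero_of_isCompact hK hU.isClosed_compl
      (disjoint_compl_right_iff_subset.2 hKU)
    refine (RealRMK.rieszMeasure_le_of_eq_one Λ (f := ⟨f, hfc⟩) (fun y => (hf y).1) hK hfK).trans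
      (ENNReal.ofReal_le_ofReal ((hLN _).trans (hb _ (fun y => (hf y).2) fun y hy => hfU hy)))
  refine ⟨RealRMK.rieszMeasure Λ, fun h => ?_, ?_, fun x r hr => hopen _ isOpen_ball _
    fun f hf1 hf0 => weightedContent_le_rpow (x := x) hr fun y _ => ?_⟩
  · have h1 := RealRMK.le_rieszMeasure_tsupport_subset Λ (f := F₀) (fun y => hf₀ y)
      (subset_univ _)
    rw [h] at h1
    have h2 : Λ F₀ = N F₀ := hLF₀
    simp [h2, hNpos.not_ge] at h1
  · refine le_antisymm ?_ zero_le
    simpa using hopen _ hE.isClosed.isOpen_compl 0 fun f _ hf0 =>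
      weightedContent_le_zero fun y hy => (hf0 y (by simpa using hy)).le
  · by_cases hy : y ∈ ball x r
    · rw [indicator_of_mem (ball_subset_closedBall hy)]
      exact hf1 y
    · rw [hf0 y hy]
      exact indicator_nonneg (fun _ _ => zero_le_one) y

/-- A compact planar set of dimension greater than `1` carries an `s`-Frostman measure. -/
theorem exists_isFrostmanMeasure_of_one_lt_dimH {E : Set ℂ} (hE : IsCompact E)
    (hdim : 1 < dimH E) :
    ∃ (s : ℝ) (μ : Measure ℂ), 1 < s ∧ s < 2 ∧ IsFrostmanMeasure μ E s := by
  -- The minimum with `2` keeps `s < 2` when the dimension is `2`; below the dimension the Hausdorff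
  -- measure is infinite.
  obtain ⟨s, hs1, hs⟩ := ENNReal.lt_iff_exists_nnreal_btwn.1
    (lt_min hdim (show (1 : ℝ≥0∞) < 2 by norm_num))
  obtain ⟨hsd, hs2⟩ := lt_min_iff.1 hs
  have h1 : (1 : ℝ) < s := by exact_mod_cast hs1
  have h2 : (s : ℝ) < 2 := by exact_mod_cast hs2
  obtain ⟨μ, hμ0, hμE, hμ⟩ := exists_measure_ball_le_rpow_of_hausdorffMeasure_ne_zero hE
    (s := s) (by linarith) (by rw [hausdorffMeasure_of_lt_dimH hsd]; exact ENNReal.top_ne_zero)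
  exact ⟨s, μ, h1, h2, hμ0, hμE, hμ⟩

end Frostman

section CauchyTransform

open Set Metric Filter Topology

/-! ### Dyadic estimates of the Riesz kernels -/

/-- If `φ` is at most `bₖ` on the part of `S` in the ball of radius `ρₖ`, these parts cover `S`, and
`bₖ ρₖ ^ s` is geometric, then the integral of `φ` is bounded by the geometric series. -/
theorem setLIntegral_le_of_geometric {X : Type*} [PseudoMetricSpace X] [MeasurableSpace X]
    [OpensMeasurableSpace X] {μ : Measure X} {s : ℝ} {z : X}
    (hμ : ∀ r : ℝ, 0 < r → μ (ball z r) ≤ ENNReal.ofReal (r ^ s)) {S : Set X}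
    (hS : MeasurableSet S) {φ : X → ℝ} {b ρ : ℕ → ℝ} (hb : ∀ k, 0 ≤ b k) (hρ : ∀ k, 0 < ρ k)
    (hφ : ∀ ζ ∈ S, φ ζ ≤ 0 ∨ ∃ k, φ ζ ≤ b k ∧ ζ ∈ ball z (ρ k)) {A q : ℝ} (hq0 : 0 ≤ q)
    (hq1 : q < 1) (hgeom : ∀ k, b k * ρ k ^ s = A * q ^ k) :
    ∫⁻ ζ in S, ENNReal.ofReal (φ ζ) ∂μ ≤ ENNReal.ofReal (A / (1 - q)) := by
  have hAq : ∀ k, 0 ≤ A * q ^ k := fun k => by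
    rw [← hgeom]; exact mul_nonneg (hb k) (Real.rpow_nonneg (hρ k).le s)
  have hsum : HasSum (fun k => A * q ^ k) (A / (1 - q)) := by
    simpa [div_eq_mul_inv] using (hasSum_geometric_of_lt_one hq0 hq1).mul_left A
  -- Dominating by the sum over all `k` avoids a partition into annuli.
  calc ∫⁻ ζ in S, ENNReal.ofReal (φ ζ) ∂μ
      ≤ ∫⁻ ζ in S, ∑' k, (ball z (ρ k)).indicator (fun _ => ENNReal.ofReal (b k)) ζ ∂μ := by
        refine setLIntegral_mono' hS fun ζ hζ => ?_
        rcases hφ ζ hζ with h | ⟨k, hk, hkρ⟩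
        · simp [ENNReal.ofReal_of_nonpos h]
        · refine le_trans ?_ (ENNReal.le_tsum k)
          rw [indicator_of_mem hkρ]
          exact ENNReal.ofReal_le_ofReal hk
    _ ≤ ∫⁻ ζ, ∑' k, (ball z (ρ k)).indicator (fun _ => ENNReal.ofReal (b k)) ζ ∂μ :=
        setLIntegral_le_lintegral _ _
    _ = ∑' k, ENNReal.ofReal (b k) * μ (ball z (ρ k)) := by
        rw [lintegral_tsum fun k => (measurable_const.indicator measurableSet_ball).aemeasurable]
        simp [lintegral_indicator_const measurableSet_ball]
    _ ≤ ∑' k, ENNReal.ofReal (A * q ^ k) := by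
        refine ENNReal.tsum_le_tsum fun k => ?_
        rw [← hgeom, ENNReal.ofReal_mul (hb k)]
        exact mul_le_mul_right (hμ _ (hρ k)) _
    _ = ENNReal.ofReal (A / (1 - q)) := by
        rw [← ENNReal.ofReal_tsum_of_nonneg hAq hsum.summable, hsum.tsum_eq]

theorem two_mul_inv_two_rpow_lt_one {s : ℝ} (hs : 1 < s) : (2 : ℝ) * 2⁻¹ ^ s < 1 := by
  have : (2⁻¹ : ℝ) ^ s < 2⁻¹ ^ (1 : ℝ) :=
    Real.rpow_lt_rpow_of_exponent_gt (by norm_num) (by norm_num) hs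
  rw [Real.rpow_one] at this
  linarith

theorem two_rpow_div_four_lt_one {s : ℝ} (hs : s < 2) : (2 : ℝ) ^ s / 4 < 1 := by
  have : (2 : ℝ) ^ s < 2 ^ (2 : ℝ) := Real.rpow_lt_rpow_of_exponent_lt one_lt_two hs
  norm_num at this
  linarith

/-- Under the growth condition of exponent `s > 1` the Riesz kernel of order `1` is integrable near
its pole. -/
theorem setLIntegral_ball_inv_dist_le {X : Type*} [PseudoMetricSpace X] [MeasurableSpace X]
    [OpensMeasurableSpace X] {μ : Measure X} {s : ℝ} (hs : 1 < s) {z : X}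
    (hμ : ∀ r : ℝ, 0 < r → μ (ball z r) ≤ ENNReal.ofReal (r ^ s)) {r : ℝ} (hr : 0 < r) :
    ∫⁻ ζ in ball z r, ENNReal.ofReal ((dist ζ z)⁻¹) ∂μ
      ≤ ENNReal.ofReal (2 * 2 ^ s * r ^ (s - 1) / (1 - 2 * 2⁻¹ ^ s)) := by
  -- On the shell `2 ^ k ≤ r / dist ζ z < 2 ^ (k + 1)` the kernel is below `b k`; the `2` in `ρ k`
  -- gives room for an open ball. The ratio is `2 * 2⁻¹ ^ s`.
  refine setLIntegral_le_of_geometric hμ measurableSet_ball (b := fun k => 2 / r * 2 ^ k)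
    (ρ := fun k => 2 * r * 2⁻¹ ^ k) (fun k => by positivity) (fun k => by positivity)
    (fun ζ hζ => ?_) (by positivity) (two_mul_inv_two_rpow_lt_one hs) fun k => ?_
  · rcases (dist_nonneg (x := ζ) (y := z)).eq_or_lt with h | h
    -- At the pole the inverse is `0⁻¹ = 0`.
    · left; simp [← h]
    · right
      obtain ⟨k, hk1, hk2⟩ := exists_nat_pow_near (x := r / dist ζ z)
        ((one_le_div h).2 (mem_ball.1 hζ).le) one_lt_two
      rw [le_div_iff₀ h] at hk1
      rw [div_lt_iff₀ h, pow_succ] at hk2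
      have h2 : (0 : ℝ) < 2 ^ k := by positivity
      refine ⟨k, ?_, ?_⟩
      · rw [inv_le_iff_one_le_mul₀ h, div_mul_eq_mul_div, div_mul_eq_mul_div, one_le_div hr]
        linarith
      · rw [mem_ball, inv_pow, ← div_eq_mul_inv, lt_div_iff₀ h2]
        nlinarith
  · rw [Real.mul_rpow (by positivity) (by positivity), Real.mul_rpow zero_le_two hr.le,
      ← Real.rpow_natCast (2⁻¹ : ℝ), ← Real.rpow_mul (by positivity), mul_comm (k : ℝ) s,
      Real.rpow_mul (by positivity), Real.rpow_natCast, mul_pow, Real.rpow_sub_one hr.ne']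
    ring

/-- Under the growth condition of exponent `s < 2` the Riesz kernel of order `2` is integrable away
from its pole. -/
theorem setLIntegral_compl_ball_inv_dist_sq_le {X : Type*} [PseudoMetricSpace X]
    [MeasurableSpace X] [OpensMeasurableSpace X] {μ : Measure X} {s : ℝ} (hs : s < 2) {z : X}
    (hμ : ∀ r : ℝ, 0 < r → μ (ball z r) ≤ ENNReal.ofReal (r ^ s)) {r : ℝ} (hr : 0 < r) :
    ∫⁻ ζ in (ball z r)ᶜ, ENNReal.ofReal ((dist ζ z ^ 2)⁻¹) ∂μ
      ≤ ENNReal.ofReal (2 ^ s * (r ^ (s - 1) / r) / (1 - 2 ^ s / 4)) := by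
  -- Shells now grow: `r * 2 ^ k ≤ dist ζ z < r * 2 ^ (k + 1)`, with ratio `2 ^ s / 4`.
  refine setLIntegral_le_of_geometric hμ measurableSet_ball.compl
    (b := fun k => ((r * 2 ^ k) ^ 2)⁻¹)
    (ρ := fun k => 2 * r * 2 ^ k) (fun k => by positivity) (fun k => by positivity)
    (fun ζ hζ => ?_) (by positivity) (two_rpow_div_four_lt_one hs) fun k => ?_
  · right
    have hζ' : r ≤ dist ζ z := by simpa using hζ
    obtain ⟨k, hk1, hk2⟩ := exists_nat_pow_near (x := dist ζ z / r)
      ((one_le_div hr).2 hζ') one_lt_two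
    rw [le_div_iff₀ hr] at hk1
    rw [div_lt_iff₀ hr, pow_succ] at hk2
    refine ⟨k, inv_anti₀ (by positivity) (pow_le_pow_left₀ (by positivity) (by linarith) 2), ?_⟩
    rw [mem_ball]
    linarith
  · rw [Real.mul_rpow (by positivity) (by positivity), Real.mul_rpow zero_le_two hr.le,
      ← Real.rpow_natCast (2 : ℝ) k, ← Real.rpow_mul (by positivity), mul_comm (k : ℝ) s,
      Real.rpow_mul (by positivity), Real.rpow_natCast, Real.rpow_natCast, div_pow,
      Real.rpow_sub_one hr.ne',
      show (4 : ℝ) ^ k = (2 ^ k) ^ 2 by rw [← pow_mul, mul_comm, pow_mul]; norm_num]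
    field_simp

/-! ### Hölder estimate -/

/-- A constant for the Hölder estimate of the Cauchy transform. -/
noncomputable def cauchyHolderConst (s : ℝ) : ℝ :=
  2 * 2 ^ s * (2 ^ (s - 1) + 3 ^ (s - 1)) / (1 - 2 * 2⁻¹ ^ s)
    + 2 ^ s * 2 ^ (s - 1) / (1 - 2 ^ s / 4)

theorem lintegral_enorm_cauchyKernel_sub_le {μ : Measure ℂ} {s : ℝ} (hs1 : 1 < s) (hs2 : s < 2)
    (hμ : ∀ (z : ℂ) (r : ℝ), 0 < r → μ (ball z r) ≤ ENNReal.ofReal (r ^ s)) {z w : ℂ}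
    (hzw : z ≠ w) :
    ∫⁻ ζ, ‖1 / (ζ - z) - 1 / (ζ - w)‖ₑ ∂μ
      ≤ ENNReal.ofReal (cauchyHolderConst s * ‖z - w‖ ^ (s - 1)) := by
  set δ := ‖z - w‖ with hδdef
  have hδ : 0 < δ := norm_pos_iff.2 (sub_ne_zero.2 hzw)
  have hq1 := sub_pos.2 (two_mul_inv_two_rpow_lt_one hs1)
  have hq2 := sub_pos.2 (two_rpow_div_four_lt_one hs2)
  have hkernel : ∀ a ζ : ℂ, ‖1 / (ζ - a)‖ₑ = ENNReal.ofReal ((dist ζ a)⁻¹) := fun a ζ => by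
    rw [← ofReal_norm, norm_div, norm_one, one_div, dist_eq_norm]
  have hmeas : ∀ a : ℂ, Measurable fun ζ : ℂ => ENNReal.ofReal ((dist ζ a)⁻¹) := fun a => by
    fun_prop
  have hnear : ∫⁻ ζ in ball z (2 * δ), ‖1 / (ζ - z) - 1 / (ζ - w)‖ₑ ∂μ
      ≤ ENNReal.ofReal (2 * 2 ^ s * (2 * δ) ^ (s - 1) / (1 - 2 * 2⁻¹ ^ s))
        + ENNReal.ofReal (2 * 2 ^ s * (3 * δ) ^ (s - 1) / (1 - 2 * 2⁻¹ ^ s)) := by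
    have hsub : ball z (2 * δ) ⊆ ball w (3 * δ) := ball_subset_ball' (by
      rw [dist_eq_norm, ← hδdef]; linarith)
    calc ∫⁻ ζ in ball z (2 * δ), ‖1 / (ζ - z) - 1 / (ζ - w)‖ₑ ∂μ
        ≤ ∫⁻ ζ in ball z (2 * δ), (ENNReal.ofReal ((dist ζ z)⁻¹)
            + ENNReal.ofReal ((dist ζ w)⁻¹)) ∂μ := by
          refine lintegral_mono fun ζ => ?_
          rw [← hkernel, ← hkernel]
          exact enorm_sub_le
      _ = ∫⁻ ζ in ball z (2 * δ), ENNReal.ofReal ((dist ζ z)⁻¹) ∂μ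
            + ∫⁻ ζ in ball z (2 * δ), ENNReal.ofReal ((dist ζ w)⁻¹) ∂μ :=
          lintegral_add_left (hmeas z) _
      _ ≤ _ := add_le_add (setLIntegral_ball_inv_dist_le hs1 (hμ z) (by positivity))
          ((lintegral_mono_set hsub).trans
            (setLIntegral_ball_inv_dist_le hs1 (hμ w) (by positivity)))
  have hfar : ∫⁻ ζ in (ball z (2 * δ))ᶜ, ‖1 / (ζ - z) - 1 / (ζ - w)‖ₑ ∂μ
      ≤ ENNReal.ofReal (2 * δ * (2 ^ s * ((2 * δ) ^ (s - 1) / (2 * δ)) / (1 - 2 ^ s / 4))) := by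
    calc ∫⁻ ζ in (ball z (2 * δ))ᶜ, ‖1 / (ζ - z) - 1 / (ζ - w)‖ₑ ∂μ
        ≤ ∫⁻ ζ in (ball z (2 * δ))ᶜ, ENNReal.ofReal (2 * δ) *
            ENNReal.ofReal ((dist ζ z ^ 2)⁻¹) ∂μ := by
          refine setLIntegral_mono' measurableSet_ball.compl fun ζ hζ => ?_
          have hd : 2 * δ ≤ dist ζ z := by simpa using hζ
          have hd0 : 0 < dist ζ z := by linarith
          -- Here `δ` is at most half of `dist ζ z`; this produces the factor `2δ` in the far bound.
          have hdw : dist ζ z / 2 ≤ dist ζ w := by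
            have h1 := dist_triangle_right ζ z w
            rw [dist_eq_norm z w, ← hδdef] at h1
            linarith
          have hdw0 : 0 < dist ζ w := by linarith
          have h1 : ζ - z ≠ 0 := sub_ne_zero.2 (dist_pos.1 hd0)
          have h2 : ζ - w ≠ 0 := sub_ne_zero.2 (dist_pos.1 hdw0)
          rw [← ENNReal.ofReal_mul (by positivity), ← ofReal_norm]
          refine ENNReal.ofReal_le_ofReal ?_
          rw [div_sub_div _ _ h1 h2, norm_div, norm_mul, ← dist_eq_norm ζ z, ← dist_eq_norm ζ w,
            show 1 * (ζ - w) - (ζ - z) * 1 = z - w by ring, ← hδdef, ← div_eq_mul_inv,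
            div_le_div_iff₀ (by positivity) (by positivity)]
          have := mul_le_mul_of_nonneg_left hdw (show 0 ≤ 2 * δ * dist ζ z by positivity)
          linarith
      _ = ENNReal.ofReal (2 * δ) *
            ∫⁻ ζ in (ball z (2 * δ))ᶜ, ENNReal.ofReal ((dist ζ z ^ 2)⁻¹) ∂μ :=
          lintegral_const_mul _ (by fun_prop)
      _ ≤ _ := by
          rw [ENNReal.ofReal_mul (by positivity : 0 ≤ 2 * δ)]
          exact mul_le_mul_right
            (setLIntegral_compl_ball_inv_dist_sq_le hs2 (hμ z) (by positivity)) _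
  rw [← lintegral_add_compl _ (measurableSet_ball (x := z) (ε := 2 * δ))]
  refine (add_le_add hnear hfar).trans_eq ?_
  rw [← ENNReal.ofReal_add (by positivity) (by positivity),
    ← ENNReal.ofReal_add (by positivity) (by positivity), cauchyHolderConst,
    Real.mul_rpow zero_le_two hδ.le, Real.mul_rpow zero_le_three hδ.le]
  congr 1
  field_simp

/-! ### Holomorphy and non-constancy -/

/-- Integrals over a compact set of the reciprocals of functions `a w * ζ + b w` are holomorphic in
the parameter `w` where the denominator has no zero. -/
theorem differentiableAt_integral_inv_of_isCompact {μ : Measure ℂ} [IsFiniteMeasure μ]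
    {K : Set ℂ} (hK : IsCompact K) (hμK : μ Kᶜ = 0) (a a' b b' w₀ : ℂ)
    (hne : ∀ ζ ∈ K, (a' * w₀ + a) * ζ + (b' * w₀ + b) ≠ 0) :
    DifferentiableAt ℂ (fun w => ∫ ζ, ((a' * w + a) * ζ + (b' * w + b))⁻¹ ∂μ) w₀ := by
  -- This affine form includes `ζ - w` for the finite chart and `w * ζ - 1` for the chart at `∞`.
  set D : ℂ → ℂ → ℂ := fun w ζ => (a' * w + a) * ζ + (b' * w + b)
  set D' : ℂ → ℂ → ℂ := fun w ζ => -(a' * ζ + b') / D w ζ ^ 2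
  have hae : ∀ᵐ ζ ∂μ, ζ ∈ K := hμK
  have hDcont : Continuous fun p : ℂ × ℂ => D p.1 p.2 := by fun_prop
  have hDζ : ∀ w, Continuous (D w) := fun w => by fun_prop
  have hinv : ContinuousOn (fun ζ => (D w₀ ζ)⁻¹) K :=
    ContinuousOn.inv₀ (hDζ w₀).continuousOn hne
  have hD'cont : ContinuousOn (D' w₀) K :=
    ContinuousOn.div (Continuous.continuousOn (by fun_prop))
      (Continuous.continuousOn ((hDζ w₀).pow 2)) fun ζ hζ => pow_ne_zero 2 (hne ζ hζ)
  obtain ⟨M, hM⟩ := hK.exists_bound_of_continuousOn hinv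
  obtain ⟨M', hM'⟩ := hK.exists_bound_of_continuousOn hD'cont
  -- Compactness of `K` gives one neighbourhood of `w₀` that serves all `ζ`; it is the domain for
  -- differentiation under the integral.
  have hev : ∀ᶠ w in 𝓝 w₀, ∀ ζ ∈ K, D w ζ ≠ 0 ∧ ‖D' w ζ‖ < M' + 1 := by
    refine hK.eventually_forall_of_forall_eventually fun ζ hζ => ?_
    have h1 : ContinuousAt (fun p : ℂ × ℂ => D' p.1 p.2) (w₀, ζ) := by
      have hnum : Continuous fun p : ℂ × ℂ => -(a' * p.2 + b') := by fun_prop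
      have hden : Continuous fun p : ℂ × ℂ => D p.1 p.2 ^ 2 := hDcont.pow 2
      have hne0 : (fun p : ℂ × ℂ => D p.1 p.2 ^ 2) (w₀, ζ) ≠ 0 := pow_ne_zero 2 (hne ζ hζ)
      exact hnum.continuousAt.div hden.continuousAt hne0
    have h2 : ‖D' w₀ ζ‖ < M' + 1 := (hM' ζ hζ).trans_lt (lt_add_one M')
    have h3 : ∀ᶠ p : ℂ × ℂ in 𝓝 (w₀, ζ), ‖D' p.1 p.2‖ < M' + 1 :=
      h1.norm.eventually_lt_const h2
    have h4 : ∀ᶠ p : ℂ × ℂ in 𝓝 (w₀, ζ), D p.1 p.2 ≠ 0 :=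
      hDcont.continuousAt.eventually_ne (hne ζ hζ)
    exact h4.and h3
  have hmeas : ∀ w, AEStronglyMeasurable (fun ζ => (D w ζ)⁻¹) μ := fun w =>
    (hDζ w).measurable.inv.aestronglyMeasurable
  have hmeas' : AEStronglyMeasurable (D' w₀) μ := by
    have h1 : Continuous fun ζ : ℂ => -(a' * ζ + b') := by fun_prop
    exact (h1.measurable.div ((hDζ w₀).pow 2).measurable).aestronglyMeasurable
  refine (hasDerivAt_integral_of_dominated_loc_of_deriv_le (F := fun w ζ => (D w ζ)⁻¹)
    (F' := D') (bound := fun _ => M' + 1) hev (Eventually.of_forall hmeas)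
    (Integrable.of_bound (hmeas w₀) M (hae.mono hM)) hmeas'
    (hae.mono fun ζ hζ w hw => (hw ζ hζ).2.le) (integrable_const _)
    (hae.mono fun ζ hζ w hw => ?_)).2.differentiableAt
  have h1 : HasDerivAt (fun w => D w ζ) (a' * ζ + b') w := by
    have h2 : HasDerivAt (fun w => (a' * w + a) * ζ) (a' * ζ) w := by
      simpa using (((hasDerivAt_id w).const_mul a').add_const a).mul_const ζ
    have h3 : HasDerivAt (fun w => b' * w + b) b' w := by
      simpa using ((hasDerivAt_id w).const_mul b').add_const b
    exact h2.add h3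
  exact h1.inv (hw ζ hζ).1

variable {μ : Measure ℂ} {E : Set ℂ} {s : ℝ}

theorem coe_mem_sphereCompl {z : ℂ} : (z : OnePoint ℂ) ∈ sphereCompl E ↔ z ∉ E := by
  simp [sphereCompl]

theorem infty_mem_sphereCompl : (∞ : OnePoint ℂ) ∈ sphereCompl E := by
  simp [sphereCompl]

theorem cauchyTransform_coe (z : ℂ) :
    cauchyTransform μ (z : OnePoint ℂ) = ∫ ζ, 1 / (ζ - z) ∂μ := rfl

/-- Pulling out `w` exposes the zero at `∞` and leaves an integral that is regular at `w = 0` when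
`μ` is finite and carried by a compact set. -/
theorem cauchyTransform_chartAtInfty (w : ℂ) :
    cauchyTransform μ (chartAtInfty w) = w * ∫ ζ, (w * ζ - 1)⁻¹ ∂μ := by
  by_cases hw : w = 0
  · simp [hw, chartAtInfty, cauchyTransform]
  · rw [chartAtInfty, if_neg hw, cauchyTransform_coe, ← integral_const_mul]
    congr 1 with ζ
    rw [show ζ - w⁻¹ = w⁻¹ * (w * ζ - 1) by field_simp, one_div, mul_inv, inv_inv]

theorem IsFrostmanMeasure.isFiniteMeasure (hμ : IsFrostmanMeasure μ E s) (hE : IsCompact E) :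
    IsFiniteMeasure μ := by
  obtain ⟨R, hR⟩ := hE.isBounded.subset_ball 0
  have hR' : E ⊆ ball 0 (max R 1) := hR.trans (ball_subset_ball (le_max_left _ _))
  refine ⟨?_⟩
  rw [← measure_add_measure_compl hE.measurableSet, hμ.supported, add_zero]
  exact ((measure_mono hR').trans (hμ.growth 0 _ (by positivity))).trans_lt ENNReal.ofReal_lt_top

theorem differentiableAt_integral_inv_mul_sub_one [IsFiniteMeasure μ] (hE : IsCompact E)
    (hμ : μ Eᶜ = 0) {w : ℂ} (hw : ∀ ζ ∈ E, w * ζ ≠ 1) :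
    DifferentiableAt ℂ (fun w => ∫ ζ, (w * ζ - 1)⁻¹ ∂μ) w := by
  simpa [sub_eq_add_neg] using differentiableAt_integral_inv_of_isCompact hE hμ 0 1 (-1) 0 w
    (by simpa [← sub_eq_add_neg, sub_eq_zero] using hw)

theorem sphereHolomorphicOn_cauchyTransform [IsFiniteMeasure μ] (hE : IsCompact E)
    (hμ : μ Eᶜ = 0) : SphereHolomorphicOn (cauchyTransform μ) (sphereCompl E) := by
  refine ⟨fun z hz => ?_, fun w hw => ?_⟩
  · have hz' : z ∉ E := coe_mem_sphereCompl.1 hz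
    have h := differentiableAt_integral_inv_of_isCompact hE hμ 1 0 0 (-1) z fun ζ hζ h => hz' <| by
      rwa [show ζ = z by linear_combination h] at hζ
    refine DifferentiableAt.differentiableWithinAt ?_
    simpa [cauchyTransform_coe, sub_eq_add_neg, add_comm] using h
  · simp only [cauchyTransform_chartAtInfty]
    refine (differentiableAt_id.mul
      (differentiableAt_integral_inv_mul_sub_one hE hμ fun ζ hζ h => ?_)).differentiableWithinAt
    have hw0 : w ≠ 0 := left_ne_zero_of_mul_eq_one h
    rw [mem_ofPred_eq, chartAtInfty, if_neg hw0, coe_mem_sphereCompl] at hw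
    exact hw (by rwa [eq_inv_of_mul_eq_one_right h] at hζ)

theorem not_exists_eqOn_const_cauchyTransform [IsFiniteMeasure μ] (hE : IsCompact E)
    (hμ : μ Eᶜ = 0) (hμ0 : μ ≠ 0) :
    ¬ ∃ c : ℂ, ∀ x ∈ sphereCompl E, cauchyTransform μ x = c := by
  rintro ⟨c, hc⟩
  obtain rfl : c = 0 := (hc ∞ infty_mem_sphereCompl).symm
  have hcont := (differentiableAt_integral_inv_mul_sub_one (w := 0) hE hμ (by simp)).continuousAt
  have hev : ∀ᶠ w : ℂ in 𝓝 0, ∀ ζ ∈ E, w * ζ ≠ 1 := by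
    refine hE.eventually_forall_of_forall_eventually fun ζ _ => ?_
    have h : Continuous fun p : ℂ × ℂ => p.1 * p.2 := by fun_prop
    exact h.continuousAt.eventually_ne (by simp)
  have hzero : ∀ᶠ w : ℂ in 𝓝[≠] 0, ∫ ζ, (w * ζ - 1)⁻¹ ∂μ = 0 := by
    filter_upwards [hev.filter_mono nhdsWithin_le_nhds, self_mem_nhdsWithin] with w hw hw0
    have hw0' : w ≠ 0 := hw0
    have h : chartAtInfty w ∈ sphereCompl E := by
      rw [chartAtInfty, if_neg hw0', coe_mem_sphereCompl]
      exact fun h => hw _ h (mul_inv_cancel₀ hw0')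
    have h2 := hc _ h
    rw [cauchyTransform_chartAtInfty] at h2
    exact (mul_eq_zero.1 h2).resolve_left hw0'
  -- The integral is continuous at `w = 0` with value `-μ.real univ`, yet vanishes at all nearby `w
  -- ≠ 0`.
  have hlim := tendsto_nhds_unique (hcont.tendsto.mono_left nhdsWithin_le_nhds)
    ((tendsto_congr' hzero).2 tendsto_const_nhds)
  have : μ.real univ = 0 := by simpa using hlim
  rw [measureReal_eq_zero_iff, Measure.measure_univ_eq_zero] at this
  exact hμ0 this

/-! ### Continuity on the sphere -/

theorem integrable_cauchyKernel [IsFiniteMeasure μ] (hs : 1 < s) {z : ℂ}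
    (hμ : ∀ r : ℝ, 0 < r → μ (ball z r) ≤ ENNReal.ofReal (r ^ s)) :
    Integrable (fun ζ => 1 / (ζ - z)) μ := by
  have hmeas : Measurable fun ζ : ℂ => 1 / (ζ - z) := by fun_prop
  rw [← integrableOn_univ, ← union_compl_self (ball z 1), integrableOn_union]
  refine ⟨⟨hmeas.aestronglyMeasurable, ?_⟩, ?_⟩
  · refine lt_of_le_of_lt ?_ ((setLIntegral_ball_inv_dist_le hs hμ one_pos).trans_lt
      ENNReal.ofReal_lt_top)
    refine lintegral_mono fun ζ => ?_
    rw [← ofReal_norm, norm_div, norm_one, one_div, dist_eq_norm]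
  · refine Integrable.of_bound hmeas.aestronglyMeasurable 1 ?_
    refine (ae_restrict_mem measurableSet_ball.compl).mono fun ζ hζ => ?_
    have h : 1 ≤ ‖ζ - z‖ := by simpa [dist_eq_norm] using hζ
    rw [norm_div, norm_one]
    exact div_le_one_of_le₀ h (norm_nonneg _)

/-- The kernel is integrable at every pole, so `z` and `w` may lie in `E`; this is what makes
`cauchyTransform μ` its own continuous extension. -/
theorem norm_cauchyTransform_sub_le [IsFiniteMeasure μ] (hs1 : 1 < s) (hs2 : s < 2)
    (hμ : ∀ (z : ℂ) (r : ℝ), 0 < r → μ (ball z r) ≤ ENNReal.ofReal (r ^ s)) (z w : ℂ) :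
    ‖cauchyTransform μ (z : OnePoint ℂ) - cauchyTransform μ (w : OnePoint ℂ)‖
      ≤ cauchyHolderConst s * ‖z - w‖ ^ (s - 1) := by
  rcases eq_or_ne z w with rfl | hzw
  · simp [Real.zero_rpow (sub_pos.2 hs1).ne']
  have hbound := lintegral_enorm_cauchyKernel_sub_le hs1 hs2 hμ hzw
  have hnonneg : 0 ≤ cauchyHolderConst s * ‖z - w‖ ^ (s - 1) := by
    have hq1 := sub_pos.2 (two_mul_inv_two_rpow_lt_one hs1)
    have hq2 := sub_pos.2 (two_rpow_div_four_lt_one hs2)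
    rw [cauchyHolderConst]
    positivity
  rw [cauchyTransform_coe, cauchyTransform_coe,
    ← integral_sub (integrable_cauchyKernel hs1 (hμ z)) (integrable_cauchyKernel hs1 (hμ w))]
  have h := (enorm_integral_le_lintegral_enorm _).trans hbound
  rwa [← ofReal_norm, ENNReal.ofReal_le_ofReal_iff hnonneg] at h

theorem tendsto_cauchyTransform_cocompact [IsFiniteMeasure μ] (hE : IsCompact E)
    (hμ : μ Eᶜ = 0) :
    Tendsto (fun z : ℂ => cauchyTransform μ (z : OnePoint ℂ)) (cocompact ℂ) (𝓝 0) := by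
  obtain ⟨R, hR⟩ := hE.isBounded.subset_closedBall 0
  have hlim : Tendsto (fun z : ℂ => μ.real univ * (‖z‖ - R)⁻¹) (cocompact ℂ) (𝓝 0) := by
    have h := (tendsto_inv_atTop_zero.comp (tendsto_atTop_add_const_right _ (-R)
      (tendsto_norm_cocompact_atTop (E := ℂ)))).const_mul (μ.real univ)
    simpa [Function.comp_def, sub_eq_add_neg] using h
  refine squeeze_zero_norm' ?_ hlim
  filter_upwards [tendsto_norm_cocompact_atTop.eventually_gt_atTop R] with z hz
  have hae : ∀ᵐ ζ ∂μ, ζ ∈ E := hμ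
  rw [cauchyTransform_coe, mul_comm]
  refine norm_integral_le_of_norm_le_const (hae.mono fun ζ hζ => ?_)
  have h1 : ‖ζ‖ ≤ R := by simpa using hR hζ
  rw [norm_div, norm_one, one_div]
  refine inv_anti₀ (by linarith) ?_
  have := norm_sub_norm_le z ζ
  rw [norm_sub_rev] at this
  linarith

theorem continuous_cauchyTransform [IsFiniteMeasure μ] (hE : IsCompact E) (hμE : μ Eᶜ = 0)
    (hs1 : 1 < s) (hs2 : s < 2)
    (hμ : ∀ (z : ℂ) (r : ℝ), 0 < r → μ (ball z r) ≤ ENNReal.ofReal (r ^ s)) :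
    Continuous (cauchyTransform μ) := by
  rw [OnePoint.continuous_iff, coclosedCompact_eq_cocompact]
  refine ⟨tendsto_cauchyTransform_cocompact hE hμE, continuous_iff_continuousAt.2 fun z => ?_⟩
  rw [ContinuousAt, tendsto_iff_norm_sub_tendsto_zero]
  refine squeeze_zero (fun _ => norm_nonneg _)
    (fun w => norm_cauchyTransform_sub_le hs1 hs2 hμ w z) ?_
  have h1 : Tendsto (fun w : ℂ => ‖w - z‖) (𝓝 z) (𝓝 0) := tendsto_iff_norm_sub_tendsto_zero.1
    tendsto_id
  have h2 := (h1.rpow_const (p := s - 1) (Or.inr (by linarith))).const_mul (cauchyHolderConst s)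
  rwa [Real.zero_rpow (sub_pos.2 hs1).ne', mul_zero] at h2

end CauchyTransform

theorem mainTheorem9 :
    (∀ E : Set ℂ, IsCompact E → 1 < dimH E →
      ¬ HInftyRemovable E ∧ ¬ ARemovable E ∧
        ∃ (s : ℝ) (μ : Measure ℂ), 1 < s ∧ s < 2 ∧ IsFrostmanMeasure μ E s) ∧
    (∀ s : ℝ, 1 < s → s < 2 → ∃ C : ℝ, ∀ (E : Set ℂ) (μ : Measure ℂ),
      IsCompact E → IsFrostmanMeasure μ E s →
        SphereHolomorphicOn (cauchyTransform μ) (sphereCompl E) ∧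
        (∀ z ∈ Eᶜ, ∀ w ∈ Eᶜ,
          ‖cauchyTransform μ (z : OnePoint ℂ) - cauchyTransform μ (w : OnePoint ℂ)‖
            ≤ C * ‖z - w‖ ^ (s - 1)) ∧
        (¬ ∃ c : ℂ, ∀ x ∈ sphereCompl E, cauchyTransform μ x = c) ∧
        ∃ g ∈ ClassA (sphereCompl E), ∀ x ∈ sphereCompl E, g x = cauchyTransform μ x) := by
  refine ⟨fun E hE hdim => ?_, fun s hs1 hs2 => ⟨cauchyHolderConst s, fun E μ hE hμ => ?_⟩⟩
  · obtain ⟨s, μ, hs1, hs2, hμ⟩ := exists_isFrostmanMeasure_of_one_lt_dimH hE hdim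
    have := hμ.isFiniteMeasure hE
    have hnc := not_exists_eqOn_const_cauchyTransform hE hμ.supported hμ.ne_zero
    have hcont := continuous_cauchyTransform hE hμ.supported hs1 hs2 hμ.growth
    have hhol := sphereHolomorphicOn_cauchyTransform hE hμ.supported
    refine ⟨fun h => hnc (h _ ⟨hhol, ?_⟩), fun h => hnc ?_, s, μ, hs1, hs2, hμ⟩
    -- Boundedness comes from continuity on the compact sphere.
    · obtain ⟨M, hM⟩ := isCompact_univ.exists_bound_of_continuousOn hcont.continuousOn
      exact ⟨M, fun x _ => hM x (Set.mem_univ x)⟩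
    · obtain ⟨c, hc⟩ := h _ ⟨hcont, hhol⟩
      exact ⟨c, fun x _ => hc x⟩
  · have := hμ.isFiniteMeasure hE
    have hhol := sphereHolomorphicOn_cauchyTransform hE hμ.supported
    exact ⟨hhol, fun z _ w _ => norm_cauchyTransform_sub_le hs1 hs2 hμ.growth z w,
      not_exists_eqOn_const_cauchyTransform hE hμ.supported hμ.ne_zero, cauchyTransform μ,
      ⟨continuous_cauchyTransform hE hμ.supported hs1 hs2 hμ.growth, hhol⟩, fun _ _ => rfl⟩
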